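/- Let $n\ge 0$ be an integer, $[m]=\{1,\dots,m\}$, and let $S_n$ be the symmetric group on $[n]$, with product $(uv)(i)=u(v(i))$. Let $K$ be a linearly ordered field (for example $\mathbb{R}$ or a subfield of $\mathbb{R}$), and let $\mathbf{k}$ be any field extension of $K$ (for example $\mathbf{k}=K$); thus $\mathbf{k}$ has characteristic $0$. Let $\gamma=(\gamma_\alpha)_{\alpha\models n}$ be a family of nonnegative elements $\gamma_\alpha\ge 0$ of $K$, indexed by the compositions $\alpha$ of $n$ (the tuples of positive integers with sum $n$), and regard the $\gamma_\alpha$ as elements of $\mathbf{k}$. For a composition $\alpha=(\alpha_1,\dots,\alpha_p)$ of $n$, let $B_\alpha\in\mathbf{k}[S_n]$ be the sum of all $w\in S_n$ such that every descent of $w$ (that is, every $i\in[n-1]$ with $w(i)>w(i+1)$) lies in $\{\alpha_1+\cdots+\alpha_j : 1\le j\le p-1\}$. Let $B_\gamma=\sum_{\alpha\models n}\gamma_\alpha B_\alpha$, and let $w_0\in S_n$ be the permutation $i\mapsto n+1-i$. A face is a tuple $F=(F_1,\dots,F_\ell)$ of nonempty, pairwise disjoint sets with union $[n]$; its length is $\ell(F)=\ell$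 and its type is the composition $(|F_1|,\dots,|F_\ell|)$ of $n$. Let $\mathcal F$ be the (finite) set of all faces. For $\alpha\models n$ and $F\in\mathcal F$, let $n_\alpha(F)$ be the number of faces $G$ of type $\alpha$ such that every block of $F$ is a subset of some block of $G$; put $\widetilde n_\alpha(F)=(-1)^{n-\ell(F)}n_\alpha(F)$ and $\widetilde n_\gamma(F)=\sum_{\alpha\models n}\gamma_\alpha\widetilde n_\alpha(F)\in\mathbf{k}$. Then the minimal polynomial over $\mathbf{k}$ of the element $w_0B_\gamma$ of $\mathbf{k}[S_n]$ is $$\prod_{c\in\{\widetilde n_\gamma(F)\,:\,F\in\mathcal F\}}(x-c),$$ where the product ranges over the distinct values of $\widetilde n_\gamma$. In particular, $w_0B_\gamma$ is diagonalizable: the left multiplication and the right multiplication by $w_0B_\gamma$ on $\mathbf{k}[S_n]$ are both diagonalizable $\mathbf{k}$-linear endomorphisms. -/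

import Mathlib

/-! ## Descent sets and the elements `B_α` of the group algebra -/

/-- The descent set of a permutation `w` of `{1, …, n}`: all `i ∈ {1, …, n - 1}` with
`w(i) > w(i + 1)`. The letter `j ∈ {1, …, n}` is the element `j - 1` of `Fin n`. -/
def descentSet {n : ℕ} (w : Equiv.Perm (Fin n)) : Set ℕ :=
  {i | 1 ≤ i ∧ ∃ h : i < n, w ⟨i, h⟩ < w ⟨i - 1, lt_of_le_of_lt (Nat.sub_le i 1) h⟩}

/-- The subset `{α₁, α₁ + α₂, …, α₁ + ⋯ + α_{k-1}}` of `{1, …, n - 1}` that corresponds to a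
composition `α = (α₁, …, α_k)` of `n`; the gaps between consecutive elements of this set together
with `0` and `n` are the parts of `α`. -/
def Composition.partialSumSet {n : ℕ} (α : Composition n) : Set ℕ :=
  {s | ∃ i, 0 < i ∧ i < α.length ∧ s = α.sizeUpTo i}

open Classical in
/-- The element `B_α` of the group algebra: the sum of all permutations whose descent set is
contained in the set of proper partial sums of `α`. -/
noncomputable def descentB (k : Type*) [CommRing k] {n : ℕ} (α : Composition n) :
    MonoidAlgebra k (Equiv.Perm (Fin n)) :=
  ∑ w : Equiv.Perm (Fin n) with descentSet w ⊆ α.partialSumSet, MonoidAlgebra.single w 1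

/-- The linear combination `B_γ = ∑_α γ_α B_α`. -/
noncomputable def weightedDescentB {k : Type*} [CommRing k] {n : ℕ} (γ : Composition n → k) :
    MonoidAlgebra k (Equiv.Perm (Fin n)) :=
  ∑ α, γ α • descentB k α

/-- The permutation `w₀ : i ↦ n + 1 - i`, as an element of the group algebra. -/
noncomputable def longestElement (k : Type*) [CommRing k] (n : ℕ) :
    MonoidAlgebra k (Equiv.Perm (Fin n)) :=
  MonoidAlgebra.single Fin.revPerm 1

/-! ## Set compositions (faces) -/

/-- A face, i.e. a set composition, of an `n`-element set: a tuple of nonempty, pairwise disjoint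
sets whose union is the whole set. -/
@[ext]
structure Face (n : ℕ) where
  blocks : List (Finset (Fin n))
  nonempty_of_mem : ∀ A ∈ blocks, A.Nonempty
  pairwise_disjoint : blocks.Pairwise Disjoint
  exists_mem : ∀ x : Fin n, ∃ A ∈ blocks, x ∈ A

namespace Face

/-- The number of blocks. -/
def length {n : ℕ} (F : Face n) : ℕ := F.blocks.length

theorem nodup {n : ℕ} (F : Face n) : F.blocks.Nodup :=
  F.pairwise_disjoint.imp_of_mem fun {A B} hA _ hd h => by
    subst h
    exact (F.nonempty_of_mem A hA).ne_empty (by simpa using hd)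

noncomputable instance {n : ℕ} : Fintype (Face n) :=
  Fintype.ofInjective (fun F : Face n => (⟨F.blocks, F.nodup⟩ : {l : List (Finset (Fin n)) // l.Nodup}))
    fun _ _ h => Face.ext (congrArg Subtype.val h)

theorem sum_map_card {n : ℕ} (F : Face n) : (F.blocks.map Finset.card).sum = n := by
  have hb : F.blocks.toFinset.biUnion id = Finset.univ := by
    ext x
    simpa using F.exists_mem x
  have hd : Set.PairwiseDisjoint (F.blocks.toFinset : Set (Finset (Fin n))) id := by
    intro A hA B hB hAB
    exact F.pairwise_disjoint.forall (by simpa using hA) (by simpa using hB) hAB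
  have h := Finset.card_biUnion hd
  rw [hb, List.sum_toFinset _ F.nodup] at h
  simpa using h.symm

/-- The type of a face: the composition of `n` formed by the sizes of its blocks. -/
def type {n : ℕ} (F : Face n) : Composition n where
  blocks := F.blocks.map Finset.card
  blocks_pos := by
    intro i hi
    obtain ⟨A, hA, rfl⟩ := List.mem_map.1 hi
    exact (F.nonempty_of_mem A hA).card_pos
  blocks_sum := F.sum_map_card

/-- `F` is contained in `G` if every block of `F` is a subset of a block of `G`. -/
def IsContained {n : ℕ} (F G : Face n) : Prop :=
  ∀ A ∈ F.blocks, ∃ B ∈ G.blocks, A ⊆ B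

end Face

/-! ## Knapsack numbers -/

open Classical in
/-- The knapsack number `n_α(F)`: the number of faces of type `α` that contain `F`. -/
noncomputable def knapsackNumber {n : ℕ} (α : Composition n) (F : Face n) : ℕ :=
  ({G : Face n | F.IsContained G ∧ G.type = α} : Finset (Face n)).card

/-- The signed knapsack number `ñ_α(F) = (-1)^(n - ℓ(F)) n_α(F)`. A face has at most `n` blocks, so
the subtraction is the true one. -/
noncomputable def signedKnapsackNumber {n : ℕ} (α : Composition n) (F : Face n) : ℤ :=
  (-1) ^ (n - F.length) * (knapsackNumber α F : ℤ)

/-- The weighted signed knapsack number `ñ_γ(F) = ∑_α γ_α ñ_α(F)`. -/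
noncomputable def weightedSignedKnapsackNumber {k : Type*} [CommRing k] {n : ℕ}
    (γ : Composition n → k) (F : Face n) : k :=
  ∑ α, γ α * (signedKnapsackNumber α F : k)

/-- The finite set `{ñ_γ(F) : F a face}` of the distinct weighted signed knapsack numbers. -/
noncomputable def weightedSignedKnapsackSet {k : Type*} [CommRing k] {n : ℕ}
    (γ : Composition n → k) : Finset k :=
  (Set.finite_range (weightedSignedKnapsackNumber γ)).toFinset

/-! ## Diagonalizability -/

/-- A linear endomorphism is diagonalizable if the space has a basis of eigenvectors. -/
def IsDiagonalizableEnd {k V : Type*} [Field k] [AddCommGroup V] [Module k V]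
    (f : Module.End k V) : Prop :=
  ∃ (s : Set V) (b : Module.Basis s k V), ∀ i, ∃ c : k, f (b i) = c • b i

/-! ## Annihilating polynomials of triangular actions -/

/-! Write `B_S` for the sum of the permutations with descents in `S`, where `S` is a set of adjacent
pairs. The `B_S` are linearly independent and `B_∅ = 1`. By Solomon's rule, `B_α B_S` is `n_α(S)
B_S` plus terms `B_R` with `R ⊋ S` and `n_α(R) > n_α(S)`; moreover `w₀ B_S = ∑_{R ⊇ S} (-1)^{|Rᶜ|}
B_R`. Hence `a = w₀ B_γ` acts triangularly, with diagonal entries `(-1)^{|Sᶜ|} n_γ(S)`, and these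
are exactly the roots of its minimal polynomial (`minpoly_eq_prod_of_triangular`).

It remains to show that the minimal polynomial is split with simple roots. Since `w₀` need not raise
`n_γ` strictly, one passes to the square: `a² = (w₀ B_γ w₀) B_γ`. Conjugation by `w₀` only reverses
`S`, which leaves `n_γ(S)` unchanged, so both factors act as `n_γ(S)` on `B_S` modulo strictly
larger values of `n_γ`. Thus `a² - c²` raises the value `c` strictly (`mul_mul_descentSum_sub_mem`),
and one factor per distinct value suffices to kill `1`. Because `γ ≥ 0`, the values `c` are
nonnegative, so the factors `(x - c)(x + c)` have no common roots; for `c = 0` the factor `x`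
already suffices.

Finally, every set of adjacent pairs comes from a face, with the same knapsack numbers and sign. -/

open Polynomial in
theorem IsDiagonalizableEnd.of_aeval_eq_zero {k V : Type*} [Field k] [AddCommGroup V] [Module k V]
    (f : Module.End k V) (s : Finset k) (h : aeval f (∏ c ∈ s, (X - C c)) = 0) :
    IsDiagonalizableEnd f := by
  have key : ∀ t : Finset k, LinearMap.ker (aeval f (∏ c ∈ t, (X - C c))) ≤
      Submodule.span k {v | ∃ c : k, f v = c • v} := by
    classical
    intro t
    induction t using Finset.induction_on with
    | empty =>
      intro v hv
      have : v = 0 := by simpa using hv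
      simp [this]
    | insert a t ha ih =>
      rw [Finset.prod_insert ha, ← Polynomial.sup_ker_aeval_eq_ker_aeval_mul_of_coprime]
      · refine sup_le (fun v hv => Submodule.subset_span ⟨a, ?_⟩) ih
        have : f v - a • v = 0 := by simpa [Module.algebraMap_end_apply] using hv
        exact sub_eq_zero.1 this
      · refine IsCoprime.prod_right fun c hc => Polynomial.isCoprime_X_sub_C_of_isUnit_sub ?_
        exact (sub_ne_zero.2 fun hac : a = c => ha (hac ▸ hc)).isUnit
  have htop : Submodule.span k {v | ∃ c : k, f v = c • v} = ⊤ := by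
    rw [eq_top_iff, ← LinearMap.ker_zero (M := V) (M₂ := V) (τ₁₂ := RingHom.id k), ← h]
    exact key s
  obtain ⟨b, hb, hspan, hli⟩ := exists_linearIndependent k {v | ∃ c : k, f v = c • v}
  refine ⟨b, Module.Basis.mk hli ?_, fun i => ?_⟩
  · rw [Subtype.range_coe, hspan, htop]
  · simpa using hb i.2

-- Each factor `f c` pushes vectors of rank `c` into strictly higher ranks, so applying the factors
-- in increasing order of rank kills everything. A rank shared by many indices costs only one
-- factor, which is what keeps the annihilator squarefree.
open Polynomial in
theorem aeval_prod_mul_eq_zero_of_rank {k A ι L : Type*} [Field k] [Ring A] [Algebra k A]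
    [Fintype ι] [LinearOrder L] (a : A) (v : ι → A) (r : ι → L) (f : L → k[X])
    (h : ∀ i, aeval a (f (r i)) * v i ∈ Submodule.span k (v '' {j | r i < r j})) (i : ι) :
    aeval a (∏ c ∈ Finset.univ.image r, f c) * v i = 0 := by
  -- Only ranks at least `r i` matter; induct on how many there are.
  have main : ∀ m : ℕ, ∀ i, ((Finset.univ.image r).filter (r i ≤ ·)).card ≤ m →
      aeval a (∏ c ∈ (Finset.univ.image r).filter (r i ≤ ·), f c) * v i = 0 := by
    intro m
    induction m with
    | zero =>
      intro i hi
      have : r i ∈ (Finset.univ.image r).filter (r i ≤ ·) := by simp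
      rw [Finset.card_eq_zero.1 (Nat.le_zero.1 hi)] at this
      simp at this
    | succ m ih =>
      intro i hi
      have hins : (Finset.univ.image r).filter (r i ≤ ·) =
          insert (r i) ((Finset.univ.image r).filter (r i < ·)) := by
        ext c
        simp only [Finset.mem_filter, Finset.mem_insert, le_iff_eq_or_lt]
        constructor
        · rintro ⟨h1, h2 | h2⟩
          · exact Or.inl h2.symm
          · exact Or.inr ⟨h1, h2⟩
        · rintro (rfl | h2)
          · simp
          · exact ⟨h2.1, Or.inr h2.2⟩
      have hni : r i ∉ (Finset.univ.image r).filter (r i < ·) := by simp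
      rw [hins, Finset.card_insert_of_notMem hni] at hi
      rw [hins, Finset.prod_insert hni, mul_comm, map_mul, mul_assoc]
      refine Submodule.span_induction (p := fun x _ =>
        aeval a (∏ c ∈ (Finset.univ.image r).filter (r i < ·), f c) * x = 0) ?_ (by simp)
        (fun x y _ _ hx hy => by rw [mul_add, hx, hy, add_zero])
        (fun c x _ hx => by rw [mul_smul_comm, hx, smul_zero]) (h i)
      rintro _ ⟨j, hj, rfl⟩
      have hsub : (Finset.univ.image r).filter (r j ≤ ·) ⊆
          (Finset.univ.image r).filter (r i < ·) := by
        intro c hc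
        rw [Finset.mem_filter] at hc ⊢
        exact ⟨hc.1, lt_of_lt_of_le hj hc.2⟩
      rw [← Finset.prod_sdiff hsub, map_mul, mul_assoc, ih j, mul_zero]
      exact (Finset.card_le_card hsub).trans (by omega)
  rw [← Finset.prod_filter_mul_prod_filter_not _ (r i ≤ ·), mul_comm, map_mul, mul_assoc,
    main _ i le_rfl, mul_zero]

-- Modulo the span of the later vectors, `v i` is a nonzero eigenvector for `d i`, so `p(a)` acts on
-- it as `p(d i)`.
open Polynomial in
theorem eval_eq_zero_of_triangular {k A ι : Type*} [Field k] [Ring A] [Algebra k A]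
    [PartialOrder ι] (a : A) (v : ι → A) (hv : LinearIndependent k v) (d : ι → k)
    (h : ∀ i, a * v i - d i • v i ∈ Submodule.span k (v '' {j | i < j})) (p : k[X])
    (hp : aeval a p = 0) (i : ι) : p.eval (d i) = 0 := by
  set V := Submodule.span k (v '' {j | i < j}) with hV
  have hstable : ∀ x ∈ V, a * x ∈ V := by
    intro x hx
    refine Submodule.span_induction (p := fun x _ => a * x ∈ V) ?_ (by simp)
      (fun x y _ _ hx hy => by rw [mul_add]; exact V.add_mem hx hy)
      (fun c x _ hx => by rw [mul_smul_comm]; exact V.smul_mem c hx) hx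
    rintro _ ⟨j, hj, rfl⟩
    have h1 : a * v j = (a * v j - d j • v j) + d j • v j := by abel
    rw [h1]
    refine V.add_mem (Submodule.span_mono (Set.image_mono fun l hl => lt_trans hj hl) (h j))
      (V.smul_mem _ (Submodule.subset_span ⟨j, hj, rfl⟩))
  have hpoly : ∀ (q : k[X]), ∀ x ∈ V, aeval a q * x ∈ V := by
    intro q
    induction q using Polynomial.induction_on' with
    | add p q hp hq =>
      intro x hx
      rw [map_add, add_mul]
      exact V.add_mem (hp x hx) (hq x hx)
    | monomial m c =>
      intro x hx
      have hpow : ∀ m : ℕ, a ^ m * x ∈ V := by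
        intro m
        induction m with
        | zero => simpa using hx
        | succ m ih => rw [pow_succ', mul_assoc]; exact hstable _ ih
      rw [aeval_monomial, ← Algebra.smul_def, smul_mul_assoc]
      exact V.smul_mem _ (hpow m)
  obtain ⟨q, hq⟩ := X_sub_C_dvd_sub_C_eval (p := p) (a := d i)
  have h2 : aeval a (p - C (p.eval (d i))) * v i ∈ V := by
    rw [hq, mul_comm, map_mul, mul_assoc]
    refine hpoly q _ ?_
    have : aeval a (X - C (d i)) * v i = a * v i - d i • v i := by
      rw [map_sub, aeval_X, aeval_C, sub_mul, Algebra.smul_def]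
    rw [this]
    exact h i
  rw [map_sub, hp, zero_sub, aeval_C, neg_mul, ← Algebra.smul_def] at h2
  by_contra hne
  have h3 : v i ∈ V := by
    have := V.smul_mem (p.eval (d i))⁻¹ (V.neg_mem h2)
    rwa [neg_neg, smul_smul, inv_mul_cancel₀ hne, one_smul] at this
  have := hv.notMem_span_image (s := {j | i < j}) (x := i) (by simp)
  exact this h3

-- The product over `s` serves only to make the minimal polynomial split with simple roots; `s` may
-- be too large. The roots themselves are read off the diagonal.
open Polynomial in
theorem minpoly_eq_prod_of_triangular {k A ι : Type*} [Field k] [Ring A] [Algebra k A]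
    [Fintype ι] [PartialOrder ι] (a : A) (v : ι → A) (hv : LinearIndependent k v) (d : ι → k)
    (h : ∀ i, a * v i - d i • v i ∈ Submodule.span k (v '' {j | i < j}))
    (i₀ : ι) (hi₀ : v i₀ = 1)
    (s : Finset k) (hs : aeval a (∏ c ∈ s, (X - C c)) = 0)
    (t : Finset k) (ht : ∀ c, c ∈ t ↔ ∃ i, d i = c) :
    minpoly k a = ∏ c ∈ t, (X - C c) := by
  classical
  have hint : IsIntegral k a := ⟨_, monic_prod_X_sub_C _ s, hs⟩
  have hmonic := minpoly.monic hint
  have hne := hmonic.ne_zero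
  have hdvd : minpoly k a ∣ ∏ c ∈ s, (X - C c) := minpoly.dvd k a hs
  have hsne : (∏ c ∈ s, (X - C c)) ≠ 0 := (monic_prod_X_sub_C _ s).ne_zero
  have hroots : (∏ c ∈ s, (X - C c)).roots = s.val := roots_prod_X_sub_C s
  have hsplit : (minpoly k a).Splits :=
    Splits.of_dvd (Splits.prod fun c _ => Splits.X_sub_C c) hsne hdvd
  have hle : (minpoly k a).roots ≤ s.val := hroots ▸ roots.le_of_dvd hsne hdvd
  have hnd : (minpoly k a).roots.Nodup := Multiset.nodup_of_le hle s.nodup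
  -- Along a linear extension every index has its own rank. The resulting annihilator may have
  -- repeated factors, but it confines the roots to the diagonal.
  have hfull : aeval a (∏ i : ι, (X - C (d i))) * v i₀ = 0 := by
    let e : ι → LinearExtension ι := toLinearExtension
    let d' : LinearExtension ι → k := d
    have he : Function.Injective e := fun _ _ hxy => hxy
    have := aeval_prod_mul_eq_zero_of_rank a v e (fun x => X - C (d' x)) (fun i => ?_) i₀
    · rwa [Finset.prod_image he.injOn] at this
    · have h1 : aeval a (X - C (d' (e i))) * v i = a * v i - d i • v i := by
        rw [map_sub, aeval_X, aeval_C, sub_mul, Algebra.smul_def]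
        rfl
      refine h1 ▸ Submodule.span_mono (Set.image_mono fun j (hj : i < j) => ?_) (h i)
      exact lt_of_le_of_ne (toLinearExtension.monotone hj.le) (he.ne hj.ne)
  rw [hi₀, mul_one] at hfull
  have hroot : ∀ c, c ∈ (minpoly k a).roots ↔ c ∈ t := by
    intro c
    rw [ht, mem_roots hne, IsRoot.def]
    constructor
    · intro hc
      obtain ⟨q, hq⟩ := minpoly.dvd k a hfull
      have : eval c (∏ i : ι, (X - C (d i))) = 0 := by
        rw [hq, eval_mul, hc, zero_mul]
      rw [eval_prod, Finset.prod_eq_zero_iff] at this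
      obtain ⟨i, -, hi⟩ := this
      exact ⟨i, by simpa [sub_eq_zero, eq_comm] using hi⟩
    · rintro ⟨i, rfl⟩
      exact eval_eq_zero_of_triangular a v hv d h _ (minpoly.aeval k a) i
  have heq : (minpoly k a).roots = t.val := by
    rw [Multiset.Nodup.ext hnd t.nodup]
    exact hroot
  rw [hsplit.eq_prod_roots_of_monic hmonic, heq]
  rfl

/-! ## Descents as subsets of the set of adjacent pairs -/

namespace DescentAlgebra

variable {n : ℕ}

/-- The smaller element of the `j`-th adjacent pair. -/
def lo (j : Fin (n - 1)) : Fin n := ⟨j, by omega⟩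

/-- The larger element of the `j`-th adjacent pair. -/
def hi (j : Fin (n - 1)) : Fin n := ⟨j + 1, by omega⟩

theorem lo_lt_hi (j : Fin (n - 1)) : lo j < hi j := by
  simp [lo, hi, Fin.lt_def]

theorem hi_injective : Function.Injective (hi : Fin (n - 1) → Fin n) := by
  intro i j h
  simpa [hi, Fin.ext_iff] using h

theorem monotone_of_lo_le_hi {α : Type*} [Preorder α] {f : Fin n → α}
    (h : ∀ j, f (lo j) ≤ f (hi j)) : Monotone f := by
  have key : ∀ m : ℕ, ∀ x y : Fin n, (y : ℕ) = x + m → f x ≤ f y := by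
    intro m
    induction m with
    | zero => intro x y hxy; rw [Fin.ext (a := y) (b := x) (by omega)]
    | succ m ih =>
      intro x y hxy
      refine (ih x ⟨x + m, by omega⟩ rfl).trans ?_
      have := h ⟨x + m, by omega⟩
      have hy : y = hi ⟨x + m, by omega⟩ := Fin.ext (by simp only [hi]; omega)
      exact this.trans_eq (congrArg f hy.symm)
  intro x y hxy
  exact key (y - x) x y (by have := Fin.le_def.1 hxy; omega)

/-- The set of adjacent pairs at which `w` descends. -/
def des (w : Equiv.Perm (Fin n)) : Finset (Fin (n - 1)) :=
  {j | w (hi j) < w (lo j)}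

theorem mem_des {w : Equiv.Perm (Fin n)} {j : Fin (n - 1)} : j ∈ des w ↔ w (hi j) < w (lo j) := by
  simp [des]

/-- The sum of all permutations with descents in `S`. -/
noncomputable def descentSum (k : Type*) [CommRing k] (S : Finset (Fin (n - 1))) :
    MonoidAlgebra k (Equiv.Perm (Fin n)) :=
  ∑ w : Equiv.Perm (Fin n) with des w ⊆ S, MonoidAlgebra.single w 1

/-! ### Stable sorting -/

theorem sort_inv_lt_iff (f : Fin n → ℕ) (x y : Fin n) :
    (Tuple.sort f)⁻¹ x < (Tuple.sort f)⁻¹ y ↔ f x < f y ∨ f x = f y ∧ x < y := by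
  obtain ⟨hmono, hst⟩ := Tuple.eq_sort_iff.1 (rfl : Tuple.sort f = Tuple.sort f)
  have key : ∀ x y, (Tuple.sort f)⁻¹ x < (Tuple.sort f)⁻¹ y → f x < f y ∨ f x = f y ∧ x < y := by
    intro x y h
    have h1 : f x ≤ f y := by simpa using hmono h.le
    rcases h1.lt_or_eq with h2 | h2
    · exact Or.inl h2
    · exact Or.inr ⟨h2, by simpa using hst _ _ h (by simpa using h2)⟩
  refine ⟨key x y, fun h => ?_⟩
  by_contra hle
  rcases (not_lt.1 hle).lt_or_eq with h1 | h1
  · rcases key y x h1 with h2 | h2 <;> rcases h with h3 | h3 <;> omega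
  · have : x = y := ((Tuple.sort f)⁻¹.injective h1).symm
    subst this
    simp at h

theorem exists_des_eq (D : Finset (Fin (n - 1))) : ∃ w : Equiv.Perm (Fin n), des w = D := by
  -- This word is weakly decreasing and drops exactly across the pairs in `D`; ranking its positions
  -- stably turns drops into descents and ties into ascents.
  let f : Fin n → ℕ := fun x => (D.filter fun d => x ≤ lo d).card
  refine ⟨(Tuple.sort f)⁻¹, ?_⟩
  ext j
  rw [mem_des, sort_inv_lt_iff]
  have hsub : (D.filter fun d => hi j ≤ lo d) ⊆ D.filter fun d => lo j ≤ lo d := by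
    intro d hd
    rw [Finset.mem_filter] at hd ⊢
    exact ⟨hd.1, (lo_lt_hi j).le.trans hd.2⟩
  have hnot : ¬ (hi j < lo j) := (lo_lt_hi j).not_gt
  simp only [hnot, and_false, or_false]
  constructor
  · intro h
    by_contra hj
    refine absurd h (not_lt.2 (Finset.card_le_card fun d hd => ?_))
    rw [Finset.mem_filter] at hd ⊢
    refine ⟨hd.1, ?_⟩
    have hne : d ≠ j := fun h => hj (h ▸ hd.1)
    have h2 := hd.2
    simp only [lo, hi, Fin.le_def] at h2 ⊢
    have : (d : ℕ) ≠ j := fun h => hne (Fin.ext h)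
    omega
  · intro hj
    refine Finset.card_lt_card (Finset.ssubset_iff_subset_ne.2 ⟨hsub, fun h => ?_⟩)
    have : j ∈ D.filter fun d => lo j ≤ lo d := by simp [hj]
    rw [← h, Finset.mem_filter] at this
    exact absurd this.2 (not_le.2 (lo_lt_hi j))

theorem descentSum_apply (k : Type*) [CommRing k] (S : Finset (Fin (n - 1)))
    (w : Equiv.Perm (Fin n)) : (descentSum k S).coeff w = if des w ⊆ S then 1 else 0 := by
  classical
  rw [descentSum, MonoidAlgebra.coeff_sum, Finset.sum_apply']
  simp [Finsupp.single_apply, Finset.sum_ite_eq']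

theorem linearIndependent_descentSum (k : Type*) [CommRing k] :
    LinearIndependent k (descentSum k : Finset (Fin (n - 1)) → _) := by
  classical
  rw [Fintype.linearIndependent_iff]
  intro g hg S
  by_contra hS
  -- At a permutation with descent set `M`, only sets containing `M` contribute; for `M` maximal in
  -- the support, only `M` itself remains.
  obtain ⟨M, hM, hmax⟩ := (Finset.univ.filter fun S => g S ≠ 0).exists_maximal
    ⟨S, by simpa using hS⟩
  obtain ⟨w, hw⟩ := exists_des_eq M
  have h := congrArg (fun x => (MonoidAlgebra.coeff x) w) hg
  simp only [MonoidAlgebra.coeff_sum, Finset.sum_apply', MonoidAlgebra.coeff_smul_apply, descentSum_apply, hw] at h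
  rw [Finset.sum_eq_single M] at h
  · simp at h hM
    exact hM h
  · intro S' _ hne
    split_ifs with hsub
    · have : g S' = 0 := by
        by_contra h0
        exact hne (le_antisymm (hmax (by simpa using h0) hsub) hsub)
      simp [this]
    · simp
  · simp

theorem descentSum_empty (k : Type*) [CommRing k] : descentSum (n := n) k ∅ = 1 := by
  classical
  have : (Finset.univ.filter fun w : Equiv.Perm (Fin n) => des w ⊆ ∅) = {1} := by
    ext w
    simp only [Finset.mem_filter, Finset.mem_univ, true_and, Finset.mem_singleton,
      Finset.subset_empty]
    constructor
    · intro h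
      refine (Equiv.Perm.monotone_iff w).1 (monotone_of_lo_le_hi fun j => ?_)
      have : j ∉ des w := by simp [h]
      rwa [mem_des, not_lt] at this
    · rintro rfl
      ext j
      simpa [mem_des] using (lo_lt_hi j).le
  rw [descentSum, this, Finset.sum_singleton]
  rfl

/-! ### Multiplication by the longest element -/

theorem longestElement_mul_self (k : Type*) [CommRing k] (n : ℕ) :
    longestElement k n * longestElement k n = 1 := by
  rw [longestElement, MonoidAlgebra.single_mul_single, mul_one, MonoidAlgebra.one_def]
  congr 1
  ext x
  simp

theorem des_revPerm_mul (w : Equiv.Perm (Fin n)) : des (Fin.revPerm * w) = (des w)ᶜ := by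
  ext j
  rw [Finset.mem_compl, mem_des, mem_des]
  simp only [Equiv.Perm.mul_apply, Fin.revPerm_apply, Fin.rev_lt_rev, not_lt]
  exact ⟨le_of_lt, fun h => h.lt_of_ne fun h' => (lo_lt_hi j).ne (w.injective h')⟩

theorem sum_neg_one_pow_card_compl (k : Type*) [CommRing k] {ι : Type*} [Fintype ι] [DecidableEq ι]
    (S : Finset ι) :
    ∑ R : Finset ι with S ⊆ R, (-1 : k) ^ Rᶜ.card = if S = Finset.univ then 1 else 0 := by
  have h1 : ∑ R : Finset ι with S ⊆ R, (-1 : k) ^ Rᶜ.card =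
      ∑ R ∈ Sᶜ.powerset, (-1 : k) ^ R.card := by
    refine Finset.sum_bij' (fun R _ => Rᶜ) (fun R _ => Rᶜ) ?_ ?_ ?_ ?_ ?_
    · intro R hR
      simpa using hR
    · intro R hR
      have h : R ⊆ Sᶜ := by simpa using hR
      simpa using Finset.subset_compl_comm.1 h
    · simp
    · simp
    · simp
  have h2 := congrArg (Int.cast : ℤ → k) (Finset.sum_powerset_neg_one_pow_card (x := Sᶜ))
  push_cast at h2
  rw [h1, h2]
  simp [Finset.compl_eq_empty_iff]

/-- Left multiplication by `w₀` complements descent sets, so `w` occurs on the left iff `S ∪ des w`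
is everything. Inclusion-exclusion over the sets containing `S ∪ des w` detects this. -/
theorem longestElement_mul_descentSum (k : Type*) [CommRing k] (S : Finset (Fin (n - 1))) :
    longestElement k n * descentSum k S =
      ∑ R : Finset (Fin (n - 1)) with S ⊆ R, (-1 : k) ^ Rᶜ.card • descentSum k R := by
  classical
  ext w
  have h1 : (longestElement k n * descentSum k S).coeff w = (descentSum k S).coeff (Fin.revPerm * w) := by
    rw [longestElement, MonoidAlgebra.coeff_single_mul_apply, one_mul]
    congr 1
  rw [h1, descentSum_apply, des_revPerm_mul, MonoidAlgebra.coeff_sum, Finset.sum_apply']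
  have h2 : ∀ R : Finset (Fin (n - 1)), ((-1 : k) ^ Rᶜ.card • descentSum k R).coeff w =
      if des w ⊆ R then (-1 : k) ^ Rᶜ.card else 0 := by
    intro R
    rw [MonoidAlgebra.coeff_smul_apply, descentSum_apply]
    simp
  simp only [h2]
  rw [← Finset.sum_filter, Finset.filter_filter]
  have h3 := sum_neg_one_pow_card_compl k (S ∪ des w)
  simp only [Finset.union_subset_iff] at h3
  rw [h3]
  congr 1
  rw [eq_iff_iff, Finset.eq_univ_iff_forall, Finset.subset_iff]
  refine forall_congr' fun j => ?_
  rw [Finset.mem_compl, Finset.mem_union]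
  tauto

theorem lo_rev (j : Fin (n - 1)) : (lo j).rev = hi j.rev := by
  ext; simp [lo, hi, Fin.val_rev]; omega

theorem hi_rev (j : Fin (n - 1)) : (hi j).rev = lo j.rev := by
  ext; simp [lo, hi, Fin.val_rev]; omega

theorem mem_des_conj {w : Equiv.Perm (Fin n)} {j : Fin (n - 1)} :
    j ∈ des (Fin.revPerm * w * Fin.revPerm) ↔ j.rev ∈ des w := by
  simp [mem_des, lo_rev, hi_rev]

theorem longestElement_conj_descentSum (k : Type*) [CommRing k] (S : Finset (Fin (n - 1))) :
    longestElement k n * descentSum k S * longestElement k n =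
      descentSum k (S.map Fin.revPerm.toEmbedding) := by
  classical
  ext w
  have h1 : (longestElement k n * descentSum k S * longestElement k n).coeff w =
      (descentSum k S).coeff (Fin.revPerm * w * Fin.revPerm) := by
    rw [longestElement, MonoidAlgebra.coeff_mul_single_apply, MonoidAlgebra.coeff_single_mul_apply, one_mul,
      mul_one, mul_assoc]
    congr 1
  rw [h1, descentSum_apply, descentSum_apply]
  congr 1
  rw [eq_iff_iff, Finset.subset_iff, Finset.subset_iff]
  simp only [mem_des_conj]
  rw [← Fin.revPerm.forall_congr_right]
  refine forall_congr' fun j => ?_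
  simp

end DescentAlgebra

namespace DescentAlgebra

variable {n : ℕ}

/-! ### Words with given content and the multiplication rule -/

/-- The weakly increasing word whose level sets are the consecutive intervals given by `α`. -/
def indexWord (α : Composition n) : Fin n → ℕ := fun x => α.index x

/-- All rearrangements of the word `indexWord α`. -/
def words (α : Composition n) : Finset (Fin n → ℕ) :=
  Finset.univ.image fun π : Equiv.Perm (Fin n) => indexWord α ∘ π

theorem mem_words {α : Composition n} {h : Fin n → ℕ} :
    h ∈ words α ↔ ∃ π : Equiv.Perm (Fin n), indexWord α ∘ π = h := by
  simp [words]

theorem comp_mem_words {α : Composition n} {h : Fin n → ℕ} (hh : h ∈ words α)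
    (σ : Equiv.Perm (Fin n)) : h ∘ σ ∈ words α := by
  obtain ⟨π, rfl⟩ := mem_words.1 hh
  exact mem_words.2 ⟨π * σ, rfl⟩

theorem lt_sizeUpTo_indexWord_succ (α : Composition n) (x : Fin n) :
    (x : ℕ) < α.sizeUpTo (indexWord α x + 1) :=
  α.lt_sizeUpTo_index_succ x

theorem sizeUpTo_indexWord_le (α : Composition n) (x : Fin n) :
    α.sizeUpTo (indexWord α x) ≤ x :=
  α.sizeUpTo_index_le x

theorem indexWord_lo_le_hi (α : Composition n) (j : Fin (n - 1)) :
    indexWord α (lo j) ≤ indexWord α (hi j) := by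
  by_contra! h
  have h1 := α.monotone_sizeUpTo (Nat.succ_le_of_lt h)
  have h2 := lt_sizeUpTo_indexWord_succ α (hi j)
  have h3 := sizeUpTo_indexWord_le α (lo j)
  have hv : ((hi j : Fin n) : ℕ) = (lo j : Fin n) + 1 := rfl
  simp only [Nat.succ_eq_add_one] at h1
  omega

theorem monotone_indexWord (α : Composition n) : Monotone (indexWord α) :=
  monotone_of_lo_le_hi (indexWord_lo_le_hi α)

/-- Pairs are numbered from `0` but descents from `1`, whence the shift. Proper partial sums are the
places where the index word jumps. -/
theorem succ_mem_partialSumSet_iff (α : Composition n) (j : Fin (n - 1)) :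
    (j : ℕ) + 1 ∈ α.partialSumSet ↔ indexWord α (lo j) < indexWord α (hi j) := by
  have hl := lt_sizeUpTo_indexWord_succ α (lo j)
  have hl' := sizeUpTo_indexWord_le α (lo j)
  have hh := lt_sizeUpTo_indexWord_succ α (hi j)
  have hh' := sizeUpTo_indexWord_le α (hi j)
  have hlo : ((lo j : Fin n) : ℕ) = j := rfl
  have hhi : ((hi j : Fin n) : ℕ) = j + 1 := rfl
  constructor
  · rintro ⟨i, -, -, h⟩
    have h1 : indexWord α (lo j) < i := by
      by_contra! hc
      have := α.monotone_sizeUpTo hc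
      omega
    have h2 : i < indexWord α (hi j) + 1 := by
      by_contra! hc
      have := α.monotone_sizeUpTo hc
      omega
    omega
  · intro h
    refine ⟨indexWord α (hi j), by omega, (α.index (hi j)).2, ?_⟩
    have := α.monotone_sizeUpTo (Nat.succ_le_of_lt h)
    simp only [Nat.succ_eq_add_one] at this
    omega

theorem descentSet_subset_partialSumSet_iff (α : Composition n) (w : Equiv.Perm (Fin n)) :
    descentSet w ⊆ α.partialSumSet ↔
      ∀ j, indexWord α (lo j) = indexWord α (hi j) → w (lo j) < w (hi j) := by
  constructor
  · intro h j hj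
    by_contra! hle
    have hlt : w (hi j) < w (lo j) := hle.lt_of_ne fun h' => (lo_lt_hi j).ne' (w.injective h')
    have : (j : ℕ) + 1 ∈ descentSet w := ⟨by omega, by omega, hlt⟩
    exact ((succ_mem_partialSumSet_iff α j).1 (h this)).ne hj
  · rintro h i ⟨h1, h2, h3⟩
    obtain ⟨i, rfl⟩ : ∃ m, i = m + 1 := ⟨i - 1, by omega⟩
    let j : Fin (n - 1) := ⟨i, by omega⟩
    refine (succ_mem_partialSumSet_iff α j).2 ((indexWord_lo_le_hi α j).lt_of_ne fun h4 => ?_)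
    exact absurd h3 (h j h4).le.not_gt

theorem descentSet_subset_iff_eq_sort (α : Composition n) (w : Equiv.Perm (Fin n)) :
    descentSet w ⊆ α.partialSumSet ↔ w = Tuple.sort (indexWord α ∘ ⇑w⁻¹) := by
  have hcomp : (indexWord α ∘ ⇑w⁻¹) ∘ w = indexWord α := by ext x; simp
  have hcomp' : ∀ x, (indexWord α ∘ ⇑w⁻¹) (w x) = indexWord α x := fun x => by simp
  rw [descentSet_subset_partialSumSet_iff, Tuple.eq_sort_iff, hcomp]
  simp only [hcomp', monotone_indexWord, true_and]
  refine ⟨fun h x y hxy hf => ?_, fun h j hj => h _ _ (lo_lt_hi j) hj⟩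
  -- Lexicographic pairs carry the increase of `w` from adjacent positions to whole blocks of `α`.
  have hm : Monotone fun x => toLex (indexWord α x, w x) := by
    refine monotone_of_lo_le_hi fun j => Prod.Lex.toLex_le_toLex.2 ?_
    rcases (indexWord_lo_le_hi α j).lt_or_eq with h1 | h1
    · exact Or.inl h1
    · exact Or.inr ⟨h1, (h j h1).le⟩
  rcases Prod.Lex.toLex_le_toLex.1 (hm hxy.le) with h1 | h1
  · exact absurd hf h1.ne
  · exact h1.2.lt_of_ne fun h' => hxy.ne (w.injective h')

theorem comp_sort_of_mem_words {α : Composition n} {h : Fin n → ℕ} (hh : h ∈ words α) :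
    h ∘ Tuple.sort h = indexWord α := by
  obtain ⟨π, rfl⟩ := mem_words.1 hh
  have h1 := Tuple.unique_monotone (f := indexWord α)
    (σ := π * Tuple.sort (indexWord α ∘ π)) (τ := 1) ?_ ?_
  · simpa [Equiv.Perm.coe_mul, Function.comp_assoc] using h1
  · simpa [Equiv.Perm.coe_mul, Function.comp_assoc] using Tuple.monotone_sort (indexWord α ∘ π)
  · simpa using monotone_indexWord α

/-- A permutation increasing on the blocks of `α` is the stable sort of the word `indexWord α ∘
w⁻¹`, and every rearrangement arises once in this way. -/
theorem descentB_eq_sum_sort (k : Type*) [CommRing k] (α : Composition n) :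
    descentB k α = ∑ h ∈ words α, MonoidAlgebra.single (Tuple.sort h) 1 := by
  classical
  have hinv : ∀ h ∈ words α, indexWord α ∘ ⇑(Tuple.sort h)⁻¹ = h := by
    intro h hh
    rw [← comp_sort_of_mem_words hh]
    ext x
    simp
  refine Finset.sum_bij' (fun w _ => indexWord α ∘ ⇑w⁻¹) (fun h _ => Tuple.sort h) ?_ ?_ ?_ ?_ ?_
  · exact fun w _ => mem_words.2 ⟨w⁻¹, rfl⟩
  · intro h hh
    rw [Finset.mem_filter, descentSet_subset_iff_eq_sort, hinv h hh]
    exact ⟨Finset.mem_univ _, rfl⟩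
  · intro w hw
    rw [Finset.mem_filter, descentSet_subset_iff_eq_sort] at hw
    exact hw.2.symm
  · exact hinv
  · intro w hw
    rw [Finset.mem_filter, descentSet_subset_iff_eq_sort] at hw
    rw [← hw.2]

theorem des_sort_inv_mul_subset_iff (h : Fin n → ℕ) (w : Equiv.Perm (Fin n))
    (S : Finset (Fin (n - 1))) :
    des ((Tuple.sort h)⁻¹ * w) ⊆ S ↔ (∀ j ∉ S, h (w (lo j)) ≤ h (w (hi j))) ∧
      des w ⊆ S ∪ ({j | h (w (lo j)) < h (w (hi j))} : Finset (Fin (n - 1))) := by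
  rw [Finset.subset_iff, Finset.subset_iff, ← forall_and]
  refine forall_congr' fun j => ?_
  rw [mem_des, mem_des, Equiv.Perm.mul_apply, Equiv.Perm.mul_apply, sort_inv_lt_iff,
    Finset.mem_union, Finset.mem_filter]
  by_cases hj : j ∈ S
  · simp [hj]
  · simp only [hj, imp_false, not_false_eq_true, true_imp_iff, Finset.mem_univ, true_and, false_or]
    constructor
    · intro h1
      refine ⟨by omega, fun h2 => ?_⟩
      by_contra h3
      exact h1 (Or.inr ⟨by omega, h2⟩)
    · rintro ⟨h1, h2⟩ (h3 | ⟨h3, h4⟩)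
      · omega
      · have := h2 h4
        omega

theorem descentB_mul_descentSum (k : Type*) [CommRing k] (α : Composition n)
    (S : Finset (Fin (n - 1))) :
    descentB k α * descentSum k S = ∑ h ∈ words α with ∀ j ∉ S, h (lo j) ≤ h (hi j),
      descentSum k (S ∪ ({j | h (lo j) < h (hi j)} : Finset (Fin (n - 1)))) := by
  classical
  ext w
  rw [descentB_eq_sum_sort, Finset.sum_mul, MonoidAlgebra.coeff_sum, MonoidAlgebra.coeff_sum,
    Finset.sum_apply', Finset.sum_apply', Finset.sum_filter]
  -- Replacing `h` by `h ∘ w` makes the condition on the word independent of `w`.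
  refine Finset.sum_bij' (fun h _ => h ∘ w) (fun h _ => h ∘ ⇑w⁻¹)
    (fun h hh => comp_mem_words hh w) (fun h hh => comp_mem_words hh w⁻¹)
    (fun h _ => by ext; simp) (fun h _ => by ext; simp) fun h _ => ?_
  rw [MonoidAlgebra.coeff_single_mul_apply, one_mul, descentSum_apply, descentSum_apply,
    ← ite_and]
  exact if_congr (des_sort_inv_mul_subset_iff h w S) rfl rfl

/-! ### Knapsack numbers of sets of adjacent pairs -/

/-- The number of rearrangements of `indexWord α` that are constant on the adjacent pairs outside
`S`. -/
def knapsackCount (α : Composition n) (S : Finset (Fin (n - 1))) : ℕ :=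
  ((words α).filter fun h => ∀ j ∉ S, h (lo j) = h (hi j)).card

theorem filter_words_subset {α : Composition n} {S R : Finset (Fin (n - 1))} (hSR : S ⊆ R) :
    ((words α).filter fun h => ∀ j ∉ S, h (lo j) = h (hi j)) ⊆
      (words α).filter fun h => ∀ j ∉ R, h (lo j) = h (hi j) := by
  intro h hh
  rw [Finset.mem_filter] at hh ⊢
  exact ⟨hh.1, fun j hj => hh.2 j fun hj' => hj (hSR hj')⟩

theorem knapsackCount_mono (α : Composition n) : Monotone (knapsackCount α) :=
  fun _ _ hSR => Finset.card_le_card (filter_words_subset hSR)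

theorem knapsackCount_map_rev (α : Composition n) (S : Finset (Fin (n - 1))) :
    knapsackCount α (S.map Fin.revPerm.toEmbedding) = knapsackCount α S := by
  have hmem : ∀ j : Fin (n - 1), j ∈ S.map Fin.revPerm.toEmbedding ↔ j.rev ∈ S := by
    intro j
    simp only [Finset.mem_map, Equiv.coe_toEmbedding, Fin.revPerm_apply]
    exact ⟨by rintro ⟨a, ha, rfl⟩; simpa using ha, fun h => ⟨_, h, Fin.rev_rev j⟩⟩
  refine Finset.card_bij' (fun h _ => h ∘ Fin.revPerm) (fun h _ => h ∘ Fin.revPerm) ?_ ?_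
    (fun h _ => by ext; simp) (fun h _ => by ext; simp)
  · intro h hh
    rw [Finset.mem_filter] at hh ⊢
    refine ⟨comp_mem_words hh.1 _, fun j hj => ?_⟩
    simpa [lo_rev, hi_rev] using (hh.2 j.rev (by simpa [hmem] using hj)).symm
  · intro h hh
    rw [Finset.mem_filter] at hh ⊢
    refine ⟨comp_mem_words hh.1 _, fun j hj => ?_⟩
    simpa [lo_rev, hi_rev] using (hh.2 j.rev (by simpa [hmem] using hj)).symm

section Weighted

/-- The weighted knapsack number of a set of adjacent pairs. -/
def weightedCount {K : Type*} [Field K] (γ : Composition n → K) (S : Finset (Fin (n - 1))) : K :=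
  ∑ α, γ α * (knapsackCount α S : K)

theorem weightedCount_map_rev {K : Type*} [Field K] (γ : Composition n → K) (S : Finset (Fin (n - 1))) :
    weightedCount γ (S.map Fin.revPerm.toEmbedding) = weightedCount γ S := by
  simp [weightedCount, knapsackCount_map_rev]

variable {K : Type*} [Field K] [LinearOrder K] [IsStrictOrderedRing K]

theorem weightedCount_nonneg {γ : Composition n → K} (hγ : ∀ α, 0 ≤ γ α)
    (S : Finset (Fin (n - 1))) : 0 ≤ weightedCount γ S :=
  Finset.sum_nonneg fun α _ => mul_nonneg (hγ α) (Nat.cast_nonneg _)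

theorem weightedCount_mono {γ : Composition n → K} (hγ : ∀ α, 0 ≤ γ α) :
    Monotone (weightedCount γ) := fun _ _ hSR =>
  Finset.sum_le_sum fun α _ =>
    mul_le_mul_of_nonneg_left (Nat.cast_le.2 (knapsackCount_mono α hSR)) (hγ α)

theorem weightedCount_lt {γ : Composition n → K} (hγ : ∀ α, 0 ≤ γ α) {α : Composition n}
    (hα : γ α ≠ 0) {S R : Finset (Fin (n - 1))} (hSR : S ⊆ R)
    (h : knapsackCount α S < knapsackCount α R) : weightedCount γ S < weightedCount γ R :=
  Finset.sum_lt_sum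
    (fun β _ => mul_le_mul_of_nonneg_left (Nat.cast_le.2 (knapsackCount_mono β hSR)) (hγ β))
    ⟨α, Finset.mem_univ α, mul_lt_mul_of_pos_left (Nat.cast_lt.2 h) ((hγ α).lt_of_ne' hα)⟩

/-! ### Triangularity of `B_α` and `B_γ` -/

/-- Words constant across all pairs outside `S` contribute one `B_S` each. Any other word ascends at
some pair outside `S`, so its `R` is strictly larger; that very word is counted for `R` but not for
`S`, so the knapsack count also grows strictly. -/
theorem descentB_mul_descentSum_sub_mem (k : Type*) [Field k] (α : Composition n)
    (S : Finset (Fin (n - 1))) :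
    descentB k α * descentSum k S - (knapsackCount α S : k) • descentSum k S ∈
      Submodule.span k (descentSum k '' {R | S ⊂ R ∧ knapsackCount α S < knapsackCount α R}) := by
  classical
  rw [descentB_mul_descentSum,
    ← Finset.sum_filter_add_sum_filter_not _ fun h => ∀ j ∉ S, h (lo j) = h (hi j),
    Finset.filter_filter, Finset.filter_filter]
  have h1 : ((words α).filter fun h => (∀ j ∉ S, h (lo j) ≤ h (hi j)) ∧
      ∀ j ∉ S, h (lo j) = h (hi j)) = (words α).filter fun h => ∀ j ∉ S, h (lo j) = h (hi j) := by
    refine Finset.filter_congr fun h _ => ⟨And.right, fun h' => ⟨fun j hj => (h' j hj).le, h'⟩⟩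
  rw [h1, Finset.sum_congr rfl (g := fun _ => descentSum k S), Finset.sum_const, knapsackCount,
    Nat.cast_smul_eq_nsmul, add_sub_cancel_left]
  · refine Submodule.sum_mem _ fun h hh => Submodule.subset_span ⟨_, ⟨?_, ?_⟩, rfl⟩
    all_goals
      rw [Finset.mem_filter] at hh
      obtain ⟨hw, hle, hne⟩ := hh
      push Not at hne
      obtain ⟨j, hj, hne⟩ := hne
      have hlt := (hle j hj).lt_of_ne hne
    · refine Finset.ssubset_iff_subset_ne.2 ⟨Finset.subset_union_left, fun h' => hj ?_⟩
      rw [h']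
      simp [hlt]
    · refine Finset.card_lt_card (Finset.ssubset_iff_subset_ne.2
        ⟨filter_words_subset Finset.subset_union_left, fun h' => hne ?_⟩)
      have hmem : h ∈ (words α).filter fun g => ∀ i ∉ S ∪
          ({j | h (lo j) < h (hi j)} : Finset (Fin (n - 1))), g (lo i) = g (hi i) := by
        refine Finset.mem_filter.2 ⟨hw, fun i hi' => ?_⟩
        simp only [Finset.mem_union, Finset.mem_filter, Finset.mem_univ, true_and, not_or,
          not_lt] at hi'
        exact (hle i hi'.1).antisymm hi'.2
      rw [← h', Finset.mem_filter] at hmem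
      exact hmem.2 j hj
  · intro h hh
    rw [Finset.mem_filter] at hh
    congr 1
    refine Finset.union_eq_left.2 fun j hj => ?_
    by_contra hjS
    exact absurd (hh.2 j hjS) (by simpa using hj : h (lo j) < h (hi j)).ne

theorem weightedDescentB_mul_descentSum_sub_mem (k : Type*) [Field k] [Algebra K k]
    {γ : Composition n → K} (hγ : ∀ α, 0 ≤ γ α)
    (S : Finset (Fin (n - 1))) :
    weightedDescentB (fun α => algebraMap K k (γ α)) * descentSum k S -
        algebraMap K k (weightedCount γ S) • descentSum k S ∈
      Submodule.span k (descentSum k '' {R | S ⊂ R ∧ weightedCount γ S < weightedCount γ R}) := by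
  have h1 : weightedDescentB (fun α => algebraMap K k (γ α)) * descentSum k S -
        algebraMap K k (weightedCount γ S) • descentSum k S =
      ∑ α, algebraMap K k (γ α) •
        (descentB k α * descentSum k S - (knapsackCount α S : k) • descentSum k S) := by
    simp only [smul_sub, Finset.sum_sub_distrib, weightedDescentB, weightedCount, Finset.sum_mul,
      smul_mul_assoc, map_sum, map_mul, map_natCast, Finset.sum_smul, smul_smul]
  rw [h1]
  refine Submodule.sum_mem _ fun α _ => ?_
  by_cases hα : γ α = 0
  · simp [hα]
  · refine Submodule.smul_mem _ _ (Submodule.span_mono (Set.image_mono fun R hR => ?_)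
      (descentB_mul_descentSum_sub_mem k α S))
    exact ⟨hR.1, weightedCount_lt hγ hα hR.1.subset hR.2⟩

end Weighted

end DescentAlgebra

/-! ### Triangularity of `w₀ B_γ` and of its square, and the minimal polynomial -/

theorem mul_mem_span_of_forall_mul_mem {k A : Type*} [Field k] [Ring A] [Algebra k A] (x : A)
    {s : Set A} {V : Submodule k A} (h : ∀ y ∈ s, x * y ∈ V) {y : A}
    (hy : y ∈ Submodule.span k s) : x * y ∈ V :=
  (Submodule.span_le (p := V.comap (LinearMap.mulLeft k x))).2 h hy

open Polynomial in
theorem aeval_mulLeft {k A : Type*} [Field k] [Ring A] [Algebra k A] (a : A) (p : k[X]) :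
    aeval (LinearMap.mulLeft k a) p = LinearMap.mulLeft k (aeval a p) :=
  aeval_algHom_apply (Algebra.lmul k A) a p

open Polynomial in
theorem aeval_mulRight {k A : Type*} [Field k] [Ring A] [Algebra k A] (a : A) (p : k[X]) :
    aeval (LinearMap.mulRight k a) p = LinearMap.mulRight k (aeval a p) := by
  induction p using Polynomial.induction_on' with
  | add p q hp hq => ext x; simp [hp, hq, mul_add]
  | monomial m c =>
    ext x
    simp [aeval_monomial, LinearMap.pow_mulRight, ← Algebra.smul_def]

theorem conj_mul_sub_smul {k A : Type*} [Field k] [Ring A] [Algebra k A] {w : A} (hw : w * w = 1)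
    (b x : A) (c : k) :
    w * b * w * (w * x * w) - c • (w * x * w) = w * (b * x - c • x) * w := by
  have h : w * b * w * (w * x * w) = w * (b * x) * w := by
    rw [show w * b * w * (w * x * w) = w * b * (w * w) * x * w by simp only [mul_assoc], hw,
      mul_one, mul_assoc w b]
  rw [h, mul_sub, sub_mul, mul_smul_comm, smul_mul_assoc]

namespace DescentAlgebra

variable {n : ℕ} {K : Type*} [Field K] [LinearOrder K] [IsStrictOrderedRing K]
  (k : Type*) [Field k] [Algebra K k]

theorem longestElement_mul_descentSum_sub_mem (k : Type*) [Field k] (S : Finset (Fin (n - 1))) :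
    longestElement k n * descentSum k S - (-1 : k) ^ Sᶜ.card • descentSum k S ∈
      Submodule.span k (descentSum k '' {R | S < R}) := by
  classical
  rw [longestElement_mul_descentSum, ← Finset.add_sum_erase _ _ (a := S) (by simp),
    add_sub_cancel_left]
  refine Submodule.sum_mem _ fun R hR => Submodule.smul_mem _ _ (Submodule.subset_span ⟨R, ?_, rfl⟩)
  simp only [Finset.mem_erase, Finset.mem_filter, Finset.mem_univ, true_and] at hR
  exact lt_of_le_of_ne hR.2 (Ne.symm hR.1)

theorem longestElement_mul_descentSum_mem (k : Type*) [Field k] {U : Set (Finset (Fin (n - 1)))}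
    (hU : IsUpperSet U) {S : Finset (Fin (n - 1))} (hS : S ∈ U) :
    longestElement k n * descentSum k S ∈ Submodule.span k (descentSum k '' U) := by
  rw [longestElement_mul_descentSum]
  refine Submodule.sum_mem _ fun R hR => Submodule.smul_mem _ _ (Submodule.subset_span ⟨R, ?_, rfl⟩)
  exact hU (by simpa using hR) hS

theorem mul_descentSum_sub_mem {γ : Composition n → K} (hγ : ∀ α, 0 ≤ γ α)
    (S : Finset (Fin (n - 1))) :
    longestElement k n * weightedDescentB (fun α => algebraMap K k (γ α)) * descentSum k S -
        ((-1 : k) ^ Sᶜ.card * algebraMap K k (weightedCount γ S)) • descentSum k S ∈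
      Submodule.span k (descentSum k '' {R | S < R}) := by
  set w := longestElement k n
  set b := weightedDescentB fun α => algebraMap K k (γ α)
  set c := algebraMap K k (weightedCount γ S)
  have h1 : w * b * descentSum k S - ((-1 : k) ^ Sᶜ.card * c) • descentSum k S =
      w * (b * descentSum k S - c • descentSum k S) +
        c • (w * descentSum k S - (-1 : k) ^ Sᶜ.card • descentSum k S) := by
    rw [mul_sub, smul_sub, smul_smul, mul_smul_comm, mul_assoc, mul_comm c]
    abel
  rw [h1]
  refine Submodule.add_mem _ (mul_mem_span_of_forall_mul_mem w ?_
    (weightedDescentB_mul_descentSum_sub_mem k hγ S))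
    (Submodule.smul_mem _ _ (longestElement_mul_descentSum_sub_mem k S))
  rintro _ ⟨R, hR, rfl⟩
  exact longestElement_mul_descentSum_mem k (isUpperSet_Ioi S) (show S < R from hR.1)

theorem weightedDescentB_mul_descentSum_sub_mem_of_lt {γ : Composition n → K}
    (hγ : ∀ α, 0 ≤ γ α) (S : Finset (Fin (n - 1))) :
    weightedDescentB (fun α => algebraMap K k (γ α)) * descentSum k S -
        algebraMap K k (weightedCount γ S) • descentSum k S ∈
      Submodule.span k (descentSum k '' {R | weightedCount γ S < weightedCount γ R}) :=
  Submodule.span_mono (Set.image_mono fun _ hR => hR.2)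
    (weightedDescentB_mul_descentSum_sub_mem k hγ S)

theorem conj_weightedDescentB_mul_descentSum_sub_mem {γ : Composition n → K}
    (hγ : ∀ α, 0 ≤ γ α) (S : Finset (Fin (n - 1))) :
    longestElement k n * weightedDescentB (fun α => algebraMap K k (γ α)) * longestElement k n *
        descentSum k S - algebraMap K k (weightedCount γ S) • descentSum k S ∈
      Submodule.span k (descentSum k '' {R | weightedCount γ S < weightedCount γ R}) := by
  set w := longestElement k n with hw
  set b := weightedDescentB fun α => algebraMap K k (γ α)
  set c := algebraMap K k (weightedCount γ S)
  have hww : w * w = 1 := longestElement_mul_self k n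
  set S' := S.map Fin.revPerm.toEmbedding
  have hS' : w * descentSum k S' * w = descentSum k S := by
    rw [← longestElement_conj_descentSum k S, ← hw, mul_assoc w, mul_assoc (w * _), hww, mul_one,
      ← mul_assoc, hww, one_mul]
  have h2 := weightedDescentB_mul_descentSum_sub_mem_of_lt k hγ S'
  rw [weightedCount_map_rev] at h2
  rw [← hS', conj_mul_sub_smul hww]
  refine (Submodule.span_le (p := (Submodule.span k (descentSum k ''
    {R | weightedCount γ S < weightedCount γ R})).comap
      (LinearMap.mulRight k w ∘ₗ LinearMap.mulLeft k w))).2 ?_ h2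
  rintro _ ⟨R, hR, rfl⟩
  refine Submodule.subset_span ⟨R.map Fin.revPerm.toEmbedding, ?_,
    (longestElement_conj_descentSum k R).symm⟩
  simpa [weightedCount_map_rev] using hR

/-- Grouping the square as `(w₀ B_γ w₀) B_γ` gives two factors that both respect the filtration by
`weightedCount`, with the same scalar on each level. -/
theorem mul_mul_descentSum_sub_mem {γ : Composition n → K} (hγ : ∀ α, 0 ≤ γ α)
    (S : Finset (Fin (n - 1))) :
    (longestElement k n * weightedDescentB (fun α => algebraMap K k (γ α))) *
      (longestElement k n * weightedDescentB (fun α => algebraMap K k (γ α))) * descentSum k S -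
        (algebraMap K k (weightedCount γ S) ^ 2) • descentSum k S ∈
      Submodule.span k (descentSum k '' {R | weightedCount γ S < weightedCount γ R}) := by
  have h1 := weightedDescentB_mul_descentSum_sub_mem_of_lt k hγ S
  have h2 := conj_weightedDescentB_mul_descentSum_sub_mem k hγ S
  set w := longestElement k n
  set b := weightedDescentB fun α => algebraMap K k (γ α)
  set c := algebraMap K k (weightedCount γ S)
  have h3 : w * b * (w * b) * descentSum k S - c ^ 2 • descentSum k S =
      w * b * w * (b * descentSum k S - c • descentSum k S) +
        c • (w * b * w * descentSum k S - c • descentSum k S) := by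
    rw [mul_sub, smul_sub, smul_smul, mul_smul_comm, sq]
    simp only [mul_assoc]
    abel
  rw [h3]
  refine Submodule.add_mem _ (mul_mem_span_of_forall_mul_mem _ ?_ h1) (Submodule.smul_mem _ _ h2)
  rintro _ ⟨R, hR, rfl⟩
  have h4 := conj_weightedDescentB_mul_descentSum_sub_mem k hγ R
  have h5 := Submodule.add_mem _ (Submodule.span_mono (Set.image_mono fun Q hQ => lt_trans hR hQ) h4)
    (Submodule.smul_mem (Submodule.span k (descentSum k ''
      {Q | weightedCount γ S < weightedCount γ Q})) (algebraMap K k (weightedCount γ R))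
      (Submodule.subset_span ⟨R, hR, rfl⟩))
  rwa [sub_add_cancel] at h5

open Polynomial in
theorem exists_aeval_prod_eq_zero {γ : Composition n → K} (hγ : ∀ α, 0 ≤ γ α) :
    ∃ s : Finset k, aeval (longestElement k n * weightedDescentB fun α => algebraMap K k (γ α))
      (∏ c ∈ s, (X - C c)) = 0 := by
  classical
  set a := longestElement k n * weightedDescentB fun α => algebraMap K k (γ α) with ha
  let pm : K → Finset k := fun c => {algebraMap K k c, algebraMap K k (-c)}
  refine ⟨(Finset.univ.image (weightedCount γ)).biUnion pm, ?_⟩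
  -- Distinct nonnegative values have disjoint sets `{c, -c}`.
  have hdisj : (↑(Finset.univ.image (weightedCount γ)) : Set K).PairwiseDisjoint pm := by
    intro x hx y hy hxy
    simp only [Finset.coe_image, Finset.coe_univ, Set.image_univ, Set.mem_range] at hx hy
    obtain ⟨S, rfl⟩ := hx
    obtain ⟨R, rfl⟩ := hy
    have hS := weightedCount_nonneg hγ S
    have hR := weightedCount_nonneg hγ R
    rw [Function.onFun, Finset.disjoint_left]
    intro c hc hc'
    simp only [pm, Finset.mem_insert, Finset.mem_singleton] at hc hc'
    have hinj := (algebraMap K k).injective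
    rcases hc with rfl | rfl <;> rcases hc' with h | h <;> have := hinj h <;> apply hxy <;> linarith
  rw [Finset.prod_biUnion hdisj]
  have h := aeval_prod_mul_eq_zero_of_rank a (descentSum k) (weightedCount γ)
    (fun c => ∏ d ∈ pm c, (X - C d)) (fun S => ?_) ∅
  · rwa [descentSum_empty, mul_one] at h
  -- At value `0` a factor `X ^ 2` would be a double root. But `B_γ B_S` already lies in the span of
  -- positive values, and `w₀` preserves that span because positivity of a monotone function defines
  -- an upper set.
  · by_cases h0 : weightedCount γ S = 0
    · have hpm : pm (weightedCount γ S) = {0} := by simp [pm, h0]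
      rw [hpm, Finset.prod_singleton, map_zero, sub_zero, aeval_X]
      have h1 := weightedDescentB_mul_descentSum_sub_mem_of_lt k hγ S
      rw [h0, map_zero, zero_smul, sub_zero] at h1
      rw [h0, ha, mul_assoc]
      refine mul_mem_span_of_forall_mul_mem _ ?_ h1
      rintro _ ⟨R, hR, rfl⟩
      exact longestElement_mul_descentSum_mem k
        (U := {R | 0 < weightedCount γ R})
        (fun Q R hQR hQ => lt_of_lt_of_le hQ (weightedCount_mono hγ hQR)) hR
    · have hne : algebraMap K k (weightedCount γ S) ≠ algebraMap K k (-weightedCount γ S) := by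
        intro h
        have := (algebraMap K k).injective h
        exact h0 (by linarith)
      simp only [pm]
      rw [Finset.prod_pair hne]
      have h1 : aeval a ((X - C (algebraMap K k (weightedCount γ S))) *
          (X - C (algebraMap K k (-weightedCount γ S)))) * descentSum k S =
          a * a * descentSum k S - algebraMap K k (weightedCount γ S) ^ 2 • descentSum k S := by
        have h2 : (X - C (algebraMap K k (weightedCount γ S))) *
            (X - C (algebraMap K k (-weightedCount γ S))) =
            X ^ 2 - C (algebraMap K k (weightedCount γ S) ^ 2) := by
          simp only [map_neg, map_pow]
          ring
        rw [h2, map_sub, map_pow, aeval_X, aeval_C, sub_mul, Algebra.smul_def, sq]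
      rw [h1]
      exact mul_mul_descentSum_sub_mem k hγ S

open Polynomial in
theorem minpoly_longestElement_mul_weightedDescentB {γ : Composition n → K} (hγ : ∀ α, 0 ≤ γ α)
    (t : Finset k) (ht : ∀ c, c ∈ t ↔ ∃ S : Finset (Fin (n - 1)),
      (-1 : k) ^ Sᶜ.card * algebraMap K k (weightedCount γ S) = c) :
    minpoly k (longestElement k n * weightedDescentB fun α => algebraMap K k (γ α)) =
      ∏ c ∈ t, (X - C c) := by
  obtain ⟨s, hs⟩ := exists_aeval_prod_eq_zero k hγ
  exact minpoly_eq_prod_of_triangular _ _ (linearIndependent_descentSum k) _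
    (mul_descentSum_sub_mem k hγ) ∅ (descentSum_empty k) s hs t ht

end DescentAlgebra

namespace DescentAlgebra

variable {n : ℕ}

/-! ### Level sets of monotone words -/

theorem eq_of_monotone_of_forall_lo_hi {f h : Fin n → ℕ} (hf : Monotone f)
    (hh : ∀ j, f (lo j) = f (hi j) → h (lo j) = h (hi j)) {x y : Fin n} (hxy : f x = f y) :
    h x = h y := by
  wlog hle : x ≤ y generalizing x y
  · exact (this hxy.symm (le_of_not_ge hle)).symm
  -- Using `h` and its order dual gives both inequalities on a level set of `f`.
  have h1 : Monotone fun x => toLex (f x, h x) := by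
    refine monotone_of_lo_le_hi fun j => Prod.Lex.toLex_le_toLex.2 ?_
    rcases (hf (lo_lt_hi j).le).lt_or_eq with h1 | h1
    · exact Or.inl h1
    · exact Or.inr ⟨h1, (hh j h1).le⟩
  have h2 : Monotone fun x => toLex (f x, OrderDual.toDual (h x)) := by
    refine monotone_of_lo_le_hi fun j => Prod.Lex.toLex_le_toLex.2 ?_
    rcases (hf (lo_lt_hi j).le).lt_or_eq with h1 | h1
    · exact Or.inl h1
    · exact Or.inr ⟨h1, (hh j h1).ge⟩
  have h3 := Prod.Lex.toLex_le_toLex.1 (h1 hle)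
  have h4 := Prod.Lex.toLex_le_toLex.1 (h2 hle)
  simp only [hxy, lt_irrefl, true_and, false_or, OrderDual.toDual_le_toDual] at h3 h4
  exact h3.antisymm h4

/-- Each level set of a monotone word has one least position, and the other positions are exactly
the upper ends of pairs with equal letters. -/
theorem card_image_add_card_eq {f : Fin n → ℕ} (hf : Monotone f) :
    (Finset.univ.image f).card +
      (Finset.univ.filter fun j : Fin (n - 1) => f (lo j) = f (hi j)).card = n := by
  classical
  set E := Finset.univ.filter fun j : Fin (n - 1) => f (lo j) = f (hi j)
  have h1 : (Finset.univ.image f) = (E.image hi)ᶜ.image f := by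
    ext i
    simp only [Finset.mem_image, Finset.mem_univ, true_and, Finset.mem_compl]
    constructor
    · rintro ⟨x, rfl⟩
      obtain ⟨y, hy, hmin⟩ := (Finset.univ.filter fun y => f y = f x).exists_minimal
        ⟨x, by simp⟩
      have hy' : f y = f x := by simpa using hy
      refine ⟨y, ?_, hy'⟩
      rintro ⟨j, hj, rfl⟩
      have hj' : f (lo j) = f (hi j) := by simpa [E] using hj
      exact absurd (hmin (y := lo j) (by simp [hj', hy']) (lo_lt_hi j).le)
        (not_le.2 (lo_lt_hi j))
    · rintro ⟨x, -, rfl⟩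
      exact ⟨x, rfl⟩
  have hinj : Set.InjOn f ((E.image hi)ᶜ : Finset (Fin n)) := by
    have key : ∀ x y : Fin n, x < y → f x = f y → y ∈ E.image hi := by
      intro x y hxy hfxy
      have hlt := Fin.lt_def.1 hxy
      let j : Fin (n - 1) := ⟨y - 1, by omega⟩
      have hy : hi j = y := Fin.ext (by simp only [hi, j]; omega)
      have hx : x ≤ lo j := Fin.le_def.2 (by simp only [lo, j]; omega)
      refine Finset.mem_image.2 ⟨j, ?_, hy⟩
      have h2 := hf hx
      have h3 := hf (lo_lt_hi j).le
      simp only [E, Finset.mem_filter, Finset.mem_univ, true_and]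
      rw [hy] at h3 ⊢
      omega
    intro x hx y hy hfxy
    simp only [Finset.coe_compl, Set.mem_compl_iff, Finset.mem_coe] at hx hy
    rcases lt_trichotomy x y with h | h | h
    · exact absurd (key x y h hfxy) hy
    · exact h
    · exact absurd (key y x h hfxy.symm) hx
  rw [h1, Finset.card_image_of_injOn hinj, ← Finset.card_image_of_injective E hi_injective,
    add_comm, Finset.card_add_card_compl, Fintype.card_fin]

/-! ### Words and permutations of their letters -/

theorem exists_perm_comp_eq {f g : Fin n → ℕ}
    (h : ∀ i, (Finset.univ.filter fun x => f x = i).card =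
      (Finset.univ.filter fun x => g x = i).card) :
    ∃ π : Equiv.Perm (Fin n), f ∘ π = g := by
  have e : ∀ i, Nonempty ({x // g x = i} ≃ {x // f x = i}) := fun i =>
    ⟨Fintype.equivOfCardEq (by rw [Fintype.card_subtype, Fintype.card_subtype, h i])⟩
  refine ⟨((Equiv.sigmaFiberEquiv g).symm.trans
    (Equiv.sigmaCongrRight fun i => (e i).some)).trans (Equiv.sigmaFiberEquiv f), ?_⟩
  ext x
  exact ((e (g x)).some ⟨x, rfl⟩).2

/-- The list of the multiplicities of the letters `0, 1, …` of a word. -/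
def content (h : Fin n → ℕ) : List ℕ :=
  (List.range (Finset.univ.image h).card).map fun i => (Finset.univ.filter fun x => h x = i).card

theorem image_comp_perm (h : Fin n → ℕ) (π : Equiv.Perm (Fin n)) :
    Finset.univ.image (h ∘ π) = Finset.univ.image h := by
  ext i
  simp only [Finset.mem_image, Finset.mem_univ, true_and, Function.comp_apply]
  exact ⟨fun ⟨x, hx⟩ => ⟨π x, hx⟩, fun ⟨x, hx⟩ => ⟨π⁻¹ x, by simpa using hx⟩⟩

theorem content_comp_perm (h : Fin n → ℕ) (π : Equiv.Perm (Fin n)) :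
    content (h ∘ π) = content h := by
  have h2 : ∀ i, (Finset.univ.filter fun x => (h ∘ π) x = i).card =
      (Finset.univ.filter fun x => h x = i).card := fun i =>
    Finset.card_bij' (fun x _ => π x) (fun x _ => π⁻¹ x) (by simp) (by simp) (by simp) (by simp)
  simp only [content, image_comp_perm, h2]

/-- The letters of the word form an initial segment of `ℕ`. -/
def IsPacked (h : Fin n → ℕ) : Prop :=
  Finset.univ.image h = Finset.range (Finset.univ.image h).card

theorem isPacked_of_iff {h : Fin n → ℕ} {m : ℕ} (hm : ∀ i, (∃ x, h x = i) ↔ i < m) :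
    Finset.univ.image h = Finset.range m ∧ IsPacked h := by
  have h1 : Finset.univ.image h = Finset.range m := by
    ext i
    simpa using hm i
  exact ⟨h1, by rw [IsPacked, h1, Finset.card_range]⟩

theorem IsPacked.comp_perm {h : Fin n → ℕ} (hh : IsPacked h) (π : Equiv.Perm (Fin n)) :
    IsPacked (h ∘ π) := by
  rwa [IsPacked, image_comp_perm]

theorem IsPacked.exists_perm {f g : Fin n → ℕ} (hf : IsPacked f) (hg : IsPacked g)
    (h : content f = content g) : ∃ π : Equiv.Perm (Fin n), f ∘ π = g := by
  have hlen : (Finset.univ.image f).card = (Finset.univ.image g).card := by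
    simpa [content] using congrArg List.length h
  refine exists_perm_comp_eq fun i => ?_
  by_cases hi' : i < (Finset.univ.image f).card
  · rw [content, content, ← hlen, List.map_inj_left] at h
    exact h i (List.mem_range.2 hi')
  · have h1 : i ∉ Finset.univ.image f := by rw [hf]; simpa using hi'
    have h2 : i ∉ Finset.univ.image g := by rw [hg, ← hlen]; simpa using hi'
    rw [Finset.filter_false_of_mem, Finset.filter_false_of_mem]
    · exact fun x _ hx => h2 (Finset.mem_image.2 ⟨x, Finset.mem_univ x, hx⟩)
    · exact fun x _ hx => h1 (Finset.mem_image.2 ⟨x, Finset.mem_univ x, hx⟩)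

theorem card_filter_index (α : Composition n) (i : Fin α.length) :
    (Finset.univ.filter fun x => indexWord α x = i).card = α.blocksFun i := by
  have : (Finset.univ.filter fun x => indexWord α x = i) =
      Finset.univ.map (α.embedding i).toEmbedding := by
    ext x
    have h1 := α.mem_range_embedding_iff' (j := x) (i := i)
    simp only [Set.mem_range] at h1
    simp only [Finset.mem_filter, Finset.mem_univ, true_and, Finset.mem_map]
    rw [show (∃ a, (α.embedding i).toEmbedding a = x) ↔ i = α.index x from h1, indexWord, Fin.ext_iff,
      eq_comm]
  rw [this, Finset.card_map, Finset.card_univ, Fintype.card_fin]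

theorem image_indexWord (α : Composition n) :
    Finset.univ.image (indexWord α) = Finset.range α.length ∧ IsPacked (indexWord α) := by
  refine isPacked_of_iff fun i => ⟨?_, fun hi' => ?_⟩
  · rintro ⟨x, rfl⟩
    exact (α.index x).2
  · have h1 := card_filter_index α ⟨i, hi'⟩
    have h2 := α.one_le_blocksFun ⟨i, hi'⟩
    obtain ⟨x, hx⟩ := Finset.card_pos.1 (h1 ▸ h2)
    exact ⟨x, by simpa using hx⟩

theorem content_indexWord (α : Composition n) : content (indexWord α) = α.blocks := by
  rw [content, (image_indexWord α).1, Finset.card_range]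
  refine List.ext_getElem (by simp) fun i h1 h2 => ?_
  simpa [Composition.blocksFun] using card_filter_index α ⟨i, h2⟩

end DescentAlgebra

/-! ## Faces as words -/

namespace Face

open DescentAlgebra

variable {n : ℕ}

/-- The position of the block that contains `x`. -/
def blockIndex (F : Face n) (x : Fin n) : ℕ := F.blocks.findIdx fun A => decide (x ∈ A)

theorem blockIndex_lt (F : Face n) (x : Fin n) : F.blockIndex x < F.blocks.length := by
  obtain ⟨A, hA, hx⟩ := F.exists_mem x
  exact List.findIdx_lt_length_of_exists ⟨A, hA, by simpa using hx⟩

theorem mem_getElem_iff (F : Face n) (x : Fin n) (i : ℕ) (hi : i < F.blocks.length) :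
    x ∈ F.blocks[i] ↔ F.blockIndex x = i := by
  have h1 : x ∈ F.blocks[F.blockIndex x]'(F.blockIndex_lt x) := by
    exact of_decide_eq_true (List.findIdx_getElem (w := F.blockIndex_lt x))
  constructor
  · intro h
    have hp := List.pairwise_iff_getElem.1 F.pairwise_disjoint
    rcases lt_trichotomy (F.blockIndex x) i with h2 | h2 | h2
    · exact absurd h (Finset.disjoint_left.1 (hp _ _ (F.blockIndex_lt x) hi h2) h1)
    · exact h2
    · exact absurd h1 (Finset.disjoint_left.1 (hp _ _ hi (F.blockIndex_lt x) h2) h)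
  · rintro rfl
    exact h1

theorem getElem_eq_filter (F : Face n) (i : ℕ) (hi : i < F.blocks.length) :
    F.blocks[i] = Finset.univ.filter fun x => F.blockIndex x = i := by
  ext x
  simpa using F.mem_getElem_iff x i hi

theorem image_blockIndex (F : Face n) :
    Finset.univ.image F.blockIndex = Finset.range F.length ∧ IsPacked F.blockIndex := by
  refine isPacked_of_iff fun i => ⟨?_, fun hi => ?_⟩
  · rintro ⟨x, rfl⟩
    exact F.blockIndex_lt x
  · obtain ⟨x, hx⟩ := F.nonempty_of_mem _ (List.getElem_mem (l := F.blocks) hi)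
    exact ⟨x, (F.mem_getElem_iff x i hi).1 hx⟩

theorem card_image_blockIndex (F : Face n) : (Finset.univ.image F.blockIndex).card = F.length := by
  rw [F.image_blockIndex.1, Finset.card_range]

theorem blockIndex_injective : Function.Injective (blockIndex : Face n → Fin n → ℕ) := by
  intro F G h
  have hlen : F.length = G.length := by
    rw [← card_image_blockIndex, h, card_image_blockIndex]
  refine Face.ext (List.ext_getElem hlen fun i h1 h2 => ?_)
  rw [getElem_eq_filter, getElem_eq_filter, h]

theorem content_blockIndex (F : Face n) : content F.blockIndex = F.type.blocks := by
  rw [content, card_image_blockIndex]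
  refine List.ext_getElem (by simp [type, length]) fun i h1 h2 => ?_
  have hi : i < F.blocks.length := by simpa [type] using h2
  simp only [List.getElem_map, List.getElem_range, type, F.getElem_eq_filter i hi]

theorem type_eq_iff (F : Face n) (α : Composition n) : F.type = α ↔ F.blockIndex ∈ words α := by
  constructor
  · rintro rfl
    refine mem_words.2 ((image_indexWord _).2.exists_perm F.image_blockIndex.2 ?_)
    rw [content_indexWord, content_blockIndex]
  · intro h
    obtain ⟨π, hπ⟩ := mem_words.1 h
    refine Composition.ext ?_
    rw [← content_blockIndex, ← hπ, content_comp_perm, content_indexWord]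

theorem exists_blockIndex_eq {h : Fin n → ℕ} (hh : IsPacked h) : ∃ F : Face n, F.blockIndex = h := by
  have hmem : ∀ i, i < (Finset.univ.image h).card ↔ ∃ x, h x = i := by
    intro i
    rw [← Finset.mem_range, ← hh]
    simp
  let F : Face n :=
    { blocks := (List.range (Finset.univ.image h).card).map fun i =>
        Finset.univ.filter fun x => h x = i
      nonempty_of_mem := by
        intro A hA
        obtain ⟨i, hi, rfl⟩ := List.mem_map.1 hA
        obtain ⟨x, hx⟩ := (hmem i).1 (List.mem_range.1 hi)
        exact ⟨x, by simpa using hx⟩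
      pairwise_disjoint := by
        refine List.pairwise_map.2 (List.pairwise_lt_range.imp fun hij => ?_)
        rw [Finset.disjoint_left]
        intro x hx hx'
        simp only [Finset.mem_filter, Finset.mem_univ, true_and] at hx hx'
        omega
      exists_mem := fun x => ⟨_, List.mem_map.2 ⟨h x, List.mem_range.2 ((hmem _).2 ⟨x, rfl⟩), rfl⟩,
        by simp⟩ }
  refine ⟨F, funext fun x => ?_⟩
  have hlt : h x < F.blocks.length := by
    simpa [F] using (hmem _).2 ⟨x, rfl⟩
  rw [← F.mem_getElem_iff x (h x) hlt]
  simp [F]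

theorem isContained_iff (F G : Face n) :
    F.IsContained G ↔ ∀ x y, F.blockIndex x = F.blockIndex y → G.blockIndex x = G.blockIndex y := by
  constructor
  · intro h x y hxy
    obtain ⟨B, hB, hsub⟩ := h _ (List.getElem_mem (F.blockIndex_lt x))
    obtain ⟨i, hi, rfl⟩ := List.getElem_of_mem hB
    have hx := hsub ((F.mem_getElem_iff x _ (F.blockIndex_lt x)).2 rfl)
    have hy := hsub ((F.mem_getElem_iff y _ (F.blockIndex_lt x)).2 hxy.symm)
    rw [mem_getElem_iff] at hx hy
    rw [hx, hy]
  · intro h A hA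
    obtain ⟨i, hi, rfl⟩ := List.getElem_of_mem hA
    obtain ⟨x, hx⟩ := F.nonempty_of_mem _ hA
    refine ⟨_, List.getElem_mem (G.blockIndex_lt x), fun y hy => ?_⟩
    rw [mem_getElem_iff] at hx hy ⊢
    exact h y x (hy.trans hx.symm)

/-- The adjacent pairs at which the sorted block index word jumps. -/
def jumps (F : Face n) : Finset (Fin (n - 1)) :=
  {j | F.blockIndex (Tuple.sort F.blockIndex (lo j)) ≠ F.blockIndex (Tuple.sort F.blockIndex (hi j))}

theorem card_compl_jumps (F : Face n) : F.jumpsᶜ.card = n - F.length := by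
  have h := card_image_add_card_eq (Tuple.monotone_sort F.blockIndex)
  rw [image_comp_perm, card_image_blockIndex] at h
  have h2 : F.jumpsᶜ = Finset.univ.filter fun j : Fin (n - 1) =>
      (F.blockIndex ∘ Tuple.sort F.blockIndex) (lo j) =
        (F.blockIndex ∘ Tuple.sort F.blockIndex) (hi j) := by
    ext j
    simp [jumps]
  rw [h2]
  omega

/-- Sorting turns the blocks of `F` into intervals, so that containment becomes a condition on
adjacent pairs. Faces of type `α` correspond to rearrangements of `indexWord α`, and composing with
the sorting permutation matches the two counts. -/
theorem knapsackNumber_eq (α : Composition n) (F : Face n) :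
    knapsackNumber α F = knapsackCount α F.jumps := by
  classical
  set σ := Tuple.sort F.blockIndex with hσ
  have key : ∀ h : Fin n → ℕ, (∀ x y, F.blockIndex x = F.blockIndex y → h x = h y) ↔
      ∀ j ∉ F.jumps, (h ∘ σ) (lo j) = (h ∘ σ) (hi j) := by
    intro h
    constructor
    · intro hh j hj
      exact hh _ _ (by simpa [jumps] using hj)
    · intro hh x y hxy
      have := eq_of_monotone_of_forall_lo_hi (h := h ∘ σ) (Tuple.monotone_sort F.blockIndex)
        (fun j hj => hh j (by simpa [jumps] using hj)) (x := σ⁻¹ x) (y := σ⁻¹ y)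
        (by simpa [← hσ] using hxy)
      simpa using this
  refine Finset.card_bij (fun G _ => G.blockIndex ∘ σ) ?_ ?_ ?_
  · intro G hG
    simp only [Finset.mem_filter, Finset.mem_univ, true_and] at hG
    rw [isContained_iff, key, type_eq_iff] at hG
    exact Finset.mem_filter.2 ⟨comp_mem_words hG.2 σ, hG.1⟩
  · intro G _ G' _ h
    exact blockIndex_injective (σ.surjective.injective_comp_right h)
  · intro h hh
    obtain ⟨hw, hc⟩ := Finset.mem_filter.1 hh
    have hw' : h ∘ ⇑σ⁻¹ ∈ words α := comp_mem_words hw σ⁻¹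
    obtain ⟨G, hG⟩ : ∃ G : Face n, G.blockIndex = h ∘ ⇑σ⁻¹ := by
      obtain ⟨π, hπ⟩ := mem_words.1 hw'
      exact exists_blockIndex_eq (hπ ▸ (image_indexWord α).2.comp_perm π)
    have hGσ : G.blockIndex ∘ σ = h := by rw [hG]; ext; simp
    refine ⟨G, ?_, hGσ⟩
    simp only [Finset.mem_filter, Finset.mem_univ, true_and]
    rw [isContained_iff, key, type_eq_iff, hGσ, hG]
    exact ⟨hc, hw'⟩

theorem jumps_surjective : Function.Surjective (jumps : Face n → Finset (Fin (n - 1))) := by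
  intro S
  -- The word `c` counts the pairs of `S` before each position: it is monotone and rises by one
  -- exactly at the pairs of `S`.
  let c : Fin n → ℕ := fun x => (S.filter fun d : Fin (n - 1) => (d : ℕ) < x).card
  have hcin : ∀ j ∈ S, c (hi j) = c (lo j) + 1 := by
    intro j hj
    have : (S.filter fun d : Fin (n - 1) => (d : ℕ) < hi j) =
        insert j (S.filter fun d : Fin (n - 1) => (d : ℕ) < lo j) := by
      ext d
      rw [Finset.mem_insert, Finset.mem_filter, Finset.mem_filter, Fin.ext_iff]
      simp only [lo, hi]
      constructor
      · rintro ⟨h1, h2⟩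
        rcases Nat.lt_succ_iff_lt_or_eq.1 h2 with h3 | h3
        · exact Or.inr ⟨h1, h3⟩
        · exact Or.inl h3
      · rintro (h1 | ⟨h1, h2⟩)
        · exact ⟨(Fin.ext h1 : d = j) ▸ hj, by omega⟩
        · exact ⟨h1, by omega⟩
    simp only [c, this]
    rw [Finset.card_insert_of_notMem]
    simp [lo]
  have hcout : ∀ j ∉ S, c (hi j) = c (lo j) := by
    intro j hj
    simp only [c]
    congr 1
    refine Finset.filter_congr fun d hd => ?_
    have : (d : ℕ) ≠ j := fun h => hj (Fin.ext h ▸ hd)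
    simp only [lo, hi]
    omega
  have hmono : Monotone c := monotone_of_lo_le_hi fun j => by
    by_cases hj : j ∈ S
    · rw [hcin j hj]; omega
    · rw [hcout j hj]
  -- A discrete intermediate value argument: starting from `0` with steps of at most one, no letter
  -- is skipped.
  have hdown : ∀ m : ℕ, ∀ y : Fin n, (y : ℕ) = m → ∀ i ≤ c y, ∃ x, c x = i := by
    intro m
    induction m with
    | zero =>
      intro y hy i hi'
      have : c y = 0 := by simp [c, hy]
      exact ⟨y, by omega⟩
    | succ m ih =>
      intro y hy i hi'
      let j : Fin (n - 1) := ⟨m, by omega⟩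
      have hyj : y = hi j := Fin.ext hy
      rw [hyj] at hi'
      by_cases hle : i ≤ c (lo j)
      · exact ih (lo j) rfl i hle
      · by_cases hj : j ∈ S
        · have := hcin j hj
          exact ⟨hi j, by omega⟩
        · have := hcout j hj
          omega
  have hpacked : IsPacked c := by
    -- This supremum is one more than the largest letter, and `0` when `n = 0`.
    refine (isPacked_of_iff (m := Finset.univ.sup fun x => c x + 1) fun i => ?_).2
    rw [Finset.lt_sup_iff]
    constructor
    · rintro ⟨x, rfl⟩
      exact ⟨x, Finset.mem_univ x, by omega⟩
    · rintro ⟨y, -, hy⟩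
      exact hdown y y rfl i (by omega)
  obtain ⟨F, hF⟩ := exists_blockIndex_eq hpacked
  refine ⟨F, ?_⟩
  ext j
  rw [jumps, Finset.mem_filter, hF, Tuple.sort_eq_refl_iff_monotone.2 hmono]
  simp only [Equiv.refl_apply, Finset.mem_univ, true_and]
  by_cases hj : j ∈ S
  · simp [hj, hcin j hj]
  · simp [hj, hcout j hj]

end Face

/-! ### From sets of adjacent pairs back to faces -/

theorem weightedSignedKnapsackNumber_algebraMap {K k : Type*} [Field K] [Field k] [Algebra K k]
    {n : ℕ} (γ : Composition n → K) (F : Face n) :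
    weightedSignedKnapsackNumber (fun α => algebraMap K k (γ α)) F =
      (-1 : k) ^ F.jumpsᶜ.card * algebraMap K k (DescentAlgebra.weightedCount γ F.jumps) := by
  simp only [weightedSignedKnapsackNumber, signedKnapsackNumber, DescentAlgebra.weightedCount,
    Face.knapsackNumber_eq, Face.card_compl_jumps, map_sum, map_mul, map_natCast, Finset.mul_sum]
  refine Finset.sum_congr rfl fun α _ => ?_
  push_cast
  ring

open DescentAlgebra in
theorem mainTheorem5 {K k : Type*} [Field K] [LinearOrder K] [IsStrictOrderedRing K]
    [Field k] [Algebra K k] (n : ℕ) (γ : Composition n → K) (hγ : ∀ α, 0 ≤ γ α) :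
    minpoly k (longestElement k n * weightedDescentB (fun α => algebraMap K k (γ α))) =
        ∏ c ∈ weightedSignedKnapsackSet (fun α => algebraMap K k (γ α)),
          (Polynomial.X - Polynomial.C c) ∧
      IsDiagonalizableEnd (LinearMap.mulLeft k
        (longestElement k n * weightedDescentB (fun α => algebraMap K k (γ α)))) ∧
      IsDiagonalizableEnd (LinearMap.mulRight k
        (longestElement k n * weightedDescentB (fun α => algebraMap K k (γ α)))) := by
  have h := minpoly_longestElement_mul_weightedDescentB k hγ
    (weightedSignedKnapsackSet fun α => algebraMap K k (γ α)) fun c => by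
      simp only [weightedSignedKnapsackSet, Set.Finite.mem_toFinset, Set.mem_range,
        weightedSignedKnapsackNumber_algebraMap]
      exact Face.jumps_surjective.exists (p := fun S =>
        (-1 : k) ^ Sᶜ.card * algebraMap K k (weightedCount γ S) = c) |>.symm
  have h0 := minpoly.aeval k
    (longestElement k n * weightedDescentB fun α => algebraMap K k (γ α))
  rw [h] at h0
  refine ⟨h, .of_aeval_eq_zero _ (weightedSignedKnapsackSet fun α => algebraMap K k (γ α)) ?_,
    .of_aeval_eq_zero _ (weightedSignedKnapsackSet fun α => algebraMap K k (γ α)) ?_⟩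
  · rw [aeval_mulLeft, h0, LinearMap.mulLeft_zero_eq_zero]
  · rw [aeval_mulRight, h0, LinearMap.mulRight_zero_eq_zero]
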